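/- Let $(X,\Sigma,m)$ be a non-atomic probability space, i.e. every $A\in\Sigma$ with $m(A)>0$ contains some $B\in\Sigma$ with $0<m(B)<m(A)$. Let $\tau:X\to X$ be an invertible (bimeasurable) measure-preserving transformation that is aperiodic, i.e. for every $n\ge 1$ and every $A\in\Sigma$ with $m(A)>0$ there is $B\in\Sigma$, $B\subseteq A$, with $m(B\,\triangle\,\tau^{-n}B)>0$; if countably many sets of $\Sigma$ separate the points of $X$ (for instance on a standard Borel or Lebesgue space), this says exactly that the set of periodic points of $\tau$ is a null set. A column of height $k\ge 1$ over a base $B\in\Sigma$ consists of pairwise disjoint sets $B,\tau B,\dots,\tau^{k-1}B$; we write $C=\bigcup_{i=0}^{k-1}\tau^iB$ for their union. A tower for $\tau$ is a sequence of pairwise disjoint columns. Then $\tau$ has a fat tower: there are measurable sets $B_n$ and heights $k_n\ge 1$ $(n\in\mathbb N)$ such that, for every $n$, the sets $B_n,\tau B_n,\dots,\tau^{k_n-1}B_n$ are pairwise disjoint, the unions $C_n=\bigcup_{i=0}^{k_n-1}\tau^iB_n$ are pairwise disjoint, and $$\sum_{n} k_n\, m(C_n)=\infty .$$ -/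

import Mathlib

open MeasureTheory
open scoped ENNReal

namespace FatTower

variable {X : Type*} [MeasurableSpace X]

/-- A measure is non-atomic if every measurable set of positive measure contains a measurable
subset of positive, strictly smaller measure. (On a general measurable space this is the usual
notion; `MeasureTheory.NoAtoms` only says that singletons are null sets.) -/
def NonAtomic (m : Measure X) : Prop :=
  ∀ A : Set X, MeasurableSet A → 0 < m A →
    ∃ B : Set X, MeasurableSet B ∧ B ⊆ A ∧ 0 < m B ∧ m B < m A

/-- `τ` is aperiodic with respect to `m`: for no `n ≥ 1` does `τ^n` act trivially (modulo null
sets) on the measurable subsets of a set of positive measure. On spaces whose points are separated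
by countably many measurable sets this says that almost every point is not periodic, see
`isAperiodic_iff_periodicPts_null`. -/
def IsAperiodic (m : Measure X) (τ : X → X) : Prop :=
  ∀ n : ℕ, 1 ≤ n → ∀ A : Set X, MeasurableSet A → 0 < m A →
    ∃ B : Set X, MeasurableSet B ∧ B ⊆ A ∧ 0 < m (symmDiff B (τ^[n] ⁻¹' B))

theorem isAperiodic_iff_periodicPts_null [MeasurableSpace.CountablySeparated X] (m : Measure X)
    (τ : X ≃ᵐ X) : IsAperiodic m τ ↔ m (Function.periodicPts τ) = 0 := by
  obtain ⟨f, hf, hinj⟩ := MeasurableSpace.measurable_injection_nat_bool_of_countablySeparated X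
  have hit : ∀ n : ℕ, Measurable (τ^[n]) := fun n => τ.measurable.iterate n
  constructor
  · intro h
    have hsub : Function.periodicPts τ ⊆ ⋃ n : ℕ, {x | τ^[n + 1] x = x} := by
      rintro x ⟨n, hn, hx⟩
      refine Set.mem_iUnion.2 ⟨n - 1, ?_⟩
      rw [Set.mem_ofPred_eq, Nat.sub_add_cancel hn]
      exact hx
    refine measure_mono_null hsub (measure_iUnion_null fun n => ?_)
    by_contra hpos
    have hmeas : MeasurableSet {x | τ^[n + 1] x = x} := by
      have he : {x | τ^[n + 1] x = x} = ⋂ i : ℕ, {x | f (τ^[n + 1] x) i = f x i} := by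
        ext x
        rw [Set.mem_iInter]
        exact ⟨fun hx i => congrArg (fun y => f y i) hx, fun hx => hinj (funext hx)⟩
      rw [he]
      exact MeasurableSet.iInter fun i => measurableSet_eq_fun
        ((measurable_pi_apply i).comp (hf.comp (hit _))) ((measurable_pi_apply i).comp hf)
    obtain ⟨B, -, hBA, hB⟩ := h (n + 1) (by omega) _ hmeas (pos_iff_ne_zero.2 hpos)
    have hEq : τ^[n + 1] ⁻¹' B = B := by
      ext x
      constructor
      · intro hx
        have h1 : τ^[n + 1] x = x := τ.injective.iterate (n + 1) (hBA hx)
        rwa [Set.mem_preimage, h1] at hx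
      · intro hx
        have h1 : τ^[n + 1] x = x := hBA hx
        rwa [Set.mem_preimage, h1]
    rw [hEq] at hB
    simp at hB
  · intro h n hn A hA hpos
    by_contra hcon
    push Not at hcon
    have key : ∀ (i : ℕ) (b : Bool),
        m (A ∩ {x | f x i = b ∧ f (τ^[n] x) i ≠ b}) = 0 := by
      intro i b
      have hS : MeasurableSet {x | f x i = b} :=
        measurableSet_eq_fun ((measurable_pi_apply i).comp hf) measurable_const
      have hD : MeasurableSet (A ∩ {x | f x i = b ∧ f (τ^[n] x) i ≠ b}) :=
        hA.inter (hS.inter (hit n hS).compl)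
      refine measure_mono_null ?_ (nonpos_iff_eq_zero.1 (hcon _ hD Set.inter_subset_left))
      intro x hx
      exact Or.inl ⟨hx, fun hx' => hx.2.2 hx'.2.1⟩
    refine hpos.ne' (measure_mono_null (t := Function.periodicPts τ ∪
      ⋃ (i : ℕ) (b : Bool), A ∩ {x | f x i = b ∧ f (τ^[n] x) i ≠ b}) ?_ ?_)
    · intro x hx
      by_cases hp : τ^[n] x = x
      · exact Or.inl ⟨n, hn, hp⟩
      · right
        obtain ⟨i, hi⟩ := Function.ne_iff.1 (fun he => hp (hinj he))
        exact Set.mem_iUnion.2 ⟨i, Set.mem_iUnion.2 ⟨f x i, hx, rfl, hi⟩⟩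
    · exact measure_union_null h
        (measure_iUnion_null fun i => measure_iUnion_null fun b => key i b)

/-- The `i`-th level `τ^i B` over the base `B`. -/
def level (τ : X → X) (B : Set X) (i : ℕ) : Set X := τ^[i] '' B

/-- The union `B ∪ τ B ∪ ⋯ ∪ τ^(k-1) B` of the levels of the column of height `k` over `B`. -/
def column (τ : X → X) (B : Set X) (k : ℕ) : Set X := ⋃ i : Fin k, level τ B i

/-- The sets `B, τ B, …, τ^(k-1) B` form a column of height `k` over the measurable base `B`. -/
structure IsColumn (τ : X → X) (B : Set X) (k : ℕ) : Prop where
  measurableSet_base : MeasurableSet B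
  one_le_height : 1 ≤ k
  disjoint_levels : Pairwise fun i j : Fin k => Disjoint (level τ B i) (level τ B j)

/-- A tower: a family of pairwise disjoint columns over the bases `B n`, of heights `k n`. -/
structure IsTower {ι : Type*} (τ : X → X) (B : ι → Set X) (k : ι → ℕ) : Prop where
  isColumn : ∀ n, IsColumn τ (B n) (k n)
  disjoint_columns : Pairwise fun i j => Disjoint (column τ (B i) (k i)) (column τ (B j) (k j))

/-- A fat tower: a tower with `∑ k_n * m (C_n) = ∞`, where `C_n` is the `n`-th column. Only an
infinite sequence of columns can have this property when `m` is finite. -/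
structure IsFatTower (m : Measure X) (τ : X → X) (B : ℕ → Set X) (k : ℕ → ℕ) : Prop where
  isTower : IsTower τ B k
  tsum_eq_top : ∑' n, (k n : ℝ≥0∞) * m (column τ (B n) (k n)) = ∞

end FatTower

namespace FatTower

variable {X : Type*} [MeasurableSpace X]

/-! The invariant σ-algebra either has an atom or it does not. On an atom `E` the restriction of `τ`
is ergodic and non-atomic. Inside `E` one builds a set `A` of positive measure that avoids, for
every `N`, a run of `k` consecutive images of some set whose union `U` satisfies `k * μ U ≥ N`.
Almost all of `U` then lies in columns of height at least `k` of the skyscraper over `A`, so the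
weighted sum is at least every `N` (`exists_small_column`, `exists_mem_column_returnBase`). Without
atoms, there are infinitely many disjoint invariant sets of positive measure. Aperiodicity gives
each of them a column filling at least half of it, as tall as desired
(`IsAperiodic.exists_column_base`), so every term of the sum can be made at least 1. -/

theorem symm_iterate_iterate (τ : X ≃ᵐ X) (n : ℕ) (x : X) : τ.symm^[n] (τ^[n] x) = x :=
  Function.LeftInverse.iterate τ.symm_apply_apply n x

theorem iterate_symm_iterate (τ : X ≃ᵐ X) (n : ℕ) (x : X) : τ^[n] (τ.symm^[n] x) = x :=
  Function.LeftInverse.iterate τ.apply_symm_apply n x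

theorem level_eq_preimage (τ : X ≃ᵐ X) (B : Set X) (n : ℕ) :
    level τ B n = τ.symm^[n] ⁻¹' B :=
  congrFun (Set.image_eq_preimage_of_inverse (symm_iterate_iterate τ n)
    (iterate_symm_iterate τ n)) B

theorem measurableSet_level (τ : X ≃ᵐ X) {B : Set X} (hB : MeasurableSet B) (n : ℕ) :
    MeasurableSet (level τ B n) := by
  rw [level_eq_preimage]
  exact τ.symm.measurable.iterate n hB

theorem measurableSet_column (τ : X ≃ᵐ X) {B : Set X} (hB : MeasurableSet B) (k : ℕ) :
    MeasurableSet (column τ B k) :=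
  MeasurableSet.iUnion fun i => measurableSet_level τ hB i

theorem measure_level {m : Measure X} {τ : X ≃ᵐ X} (hτ : MeasurePreserving τ m m) {B : Set X}
    (hB : MeasurableSet B) (n : ℕ) : m (level τ B n) = m B := by
  rw [level_eq_preimage]
  exact (hτ.symm.iterate n).measure_preimage hB.nullMeasurableSet

theorem mem_column {X : Type*} {τ : X → X} {B : Set X} {k : ℕ} {x : X} :
    x ∈ column τ B k ↔ ∃ i < k, ∃ y ∈ B, τ^[i] y = x := by
  simp only [column, level, Set.mem_iUnion, Set.mem_image]
  exact ⟨fun ⟨i, h⟩ => ⟨i, i.2, h⟩, fun ⟨i, hi, h⟩ => ⟨⟨i, hi⟩, h⟩⟩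

/-! ### Bases without early returns -/

/-- No point of `B` returns to `B` before time `k`. -/
def NoReturnBefore {X : Type*} (τ : X → X) (B : Set X) (k : ℕ) : Prop :=
  ∀ x ∈ B, ∀ n, 1 ≤ n → n < k → τ^[n] x ∉ B

theorem NoReturnBefore.mono {X : Type*} {τ : X → X} {A B : Set X} {k : ℕ} (h : NoReturnBefore τ B k)
    (hAB : A ⊆ B) : NoReturnBefore τ A k :=
  fun x hx n h1 hn hx' => h x (hAB hx) n h1 hn (hAB hx')

/-- Two times at which the orbits of points of `B` meet agree if both are less than `k`. -/
theorem NoReturnBefore.eq_of_iterate_eq {τ : X ≃ᵐ X} {B : Set X} {k i j : ℕ}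
    (h : NoReturnBefore τ B k) (hi : i < k) (hj : j < k) {x y : X} (hx : x ∈ B) (hy : y ∈ B)
    (hxy : τ^[i] x = τ^[j] y) : i = j := by
  wlog hij : i ≤ j generalizing i j x y
  · exact (this hj hi hy hx hxy.symm (by omega)).symm
  by_contra hne
  refine h y hy (j - i) (by omega) (by omega) ?_
  have : τ^[i] x = τ^[i] (τ^[j - i] y) := by
    rw [hxy, ← Function.iterate_add_apply, Nat.add_sub_cancel' hij]
  rwa [← τ.injective.iterate i this]

theorem NoReturnBefore.isColumn {τ : X ≃ᵐ X} {B : Set X} {k : ℕ} (h : NoReturnBefore τ B k)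
    (hB : MeasurableSet B) (hk : 1 ≤ k) : IsColumn τ B k where
  measurableSet_base := hB
  one_le_height := hk
  disjoint_levels := by
    intro i j hij
    rw [Set.disjoint_left]
    rintro _ ⟨x, hx, rfl⟩ ⟨y, hy, hxy⟩
    exact hij (Fin.ext (h.eq_of_iterate_eq j.2 i.2 hy hx hxy).symm)

theorem IsColumn.measure_column {m : Measure X} {τ : X ≃ᵐ X} (hτ : MeasurePreserving τ m m)
    {B : Set X} {k : ℕ} (h : IsColumn τ B k) : m (column τ B k) = k * m B := by
  rw [column, measure_iUnion h.disjoint_levels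
    fun i => measurableSet_level τ h.measurableSet_base i]
  simp [measure_level hτ h.measurableSet_base]

/-- Under an aperiodic transformation every set of positive measure contains a set of positive
measure without returns before a given time. -/
theorem IsAperiodic.exists_noReturnBefore {m : Measure X} [IsFiniteMeasure m] {τ : X ≃ᵐ X}
    (hτ : MeasurePreserving τ m m) (haper : IsAperiodic m τ) (k : ℕ) {A : Set X}
    (hA : MeasurableSet A) (hpos : 0 < m A) :
    ∃ B ⊆ A, MeasurableSet B ∧ 0 < m B ∧ NoReturnBefore τ B k := by
  induction k with
  | zero => exact ⟨A, subset_rfl, hA, hpos, fun _ _ n _ hn => absurd hn (by omega)⟩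
  | succ k ih =>
    obtain ⟨A', hA'A, hA', hpos', hret⟩ := ih
    rcases Nat.eq_zero_or_pos k with rfl | hk
    · exact ⟨A', hA'A, hA', hpos', fun _ _ n _ hn => absurd hn (by omega)⟩
    obtain ⟨B, hB, hBA, hBpos⟩ := haper k hk A' hA' hpos'
    have hpre : MeasurableSet (τ^[k] ⁻¹' B) := τ.measurable.iterate k hB
    -- Since `τ^k` preserves measure, the two halves of the symmetric difference have equal measure,
    -- so this half is positive.
    refine ⟨B \ τ^[k] ⁻¹' B, Set.sdiff_subset.trans (hBA.trans hA'A), hB.diff hpre, ?_, ?_⟩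
    · rw [pos_iff_ne_zero]
      intro h0
      have h1 : m (τ^[k] ⁻¹' B \ B) = 0 := by
        rw [← h0]
        exact measure_sdiff_symm hpre.nullMeasurableSet hB.nullMeasurableSet
          ((hτ.iterate k).measure_preimage hB.nullMeasurableSet) (measure_ne_top _ _)
      exact hBpos.ne' (measure_union_null h0 h1)
    · intro x hx n h1 hn hx'
      rcases Nat.lt_succ_iff_lt_or_eq.1 hn with hn | rfl
      · exact hret x (hBA hx.1) n h1 hn (hBA hx'.1)
      · exact hx.2 hx'.1

/-! ### Columns filling half of every invariant set -/

/-- Exhaustion: a class of sets closed under increasing countable unions has an element that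
no larger element exceeds in measure. -/
theorem exists_measure_maximal (m : Measure X) [IsFiniteMeasure m] {P : Set X → Prop}
    (h0 : P ∅) (hU : ∀ s : ℕ → Set X, Monotone s → (∀ n, P (s n)) → P (⋃ n, s n)) :
    ∃ B, P B ∧ ∀ B', P B' → B ⊆ B' → m B' ≤ m B := by
  -- Greedy choice: `B` comes within `1/(n+1)` of the supremum of measures over all admissible
  -- supersets of `A`.
  have step : ∀ (n : ℕ) (A : {A // P A}), ∃ B : {B // P B}, A.1 ⊆ B.1 ∧
      ∀ B', P B' → A.1 ⊆ B' → m B' ≤ m B.1 + ((n : ℝ≥0∞) + 1)⁻¹ := by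
    intro n A
    by_contra! hcon
    set s : ℝ≥0∞ := ⨆ B : {B // P B ∧ A.1 ⊆ B}, m B.1 with hs
    have hle : ∀ B : {B // P B ∧ A.1 ⊆ B}, m B.1 + ((n : ℝ≥0∞) + 1)⁻¹ ≤ s := by
      rintro ⟨B, hPB, hAB⟩
      obtain ⟨B', hPB', hAB', hlt⟩ := hcon ⟨B, hPB⟩ hAB
      exact hlt.le.trans (le_iSup (fun B : {B // P B ∧ A.1 ⊆ B} => m B.1) ⟨B', hPB', hAB'⟩)
    have : Nonempty {B // P B ∧ A.1 ⊆ B} := ⟨⟨A.1, A.2, subset_rfl⟩⟩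
    have hsle : s + ((n : ℝ≥0∞) + 1)⁻¹ ≤ s := by
      rw [hs, ENNReal.iSup_add]
      exact iSup_le hle
    have hst : s ≠ ∞ := ne_top_of_le_ne_top (measure_ne_top m Set.univ)
      (iSup_le fun B => measure_mono (Set.subset_univ _))
    refine (ENNReal.lt_add_right hst ?_).not_ge hsle
    exact ENNReal.inv_ne_zero.2 (ENNReal.add_ne_top.2 ⟨ENNReal.natCast_ne_top n, ENNReal.one_ne_top⟩)
  choose f hf hf' using step
  let s : ℕ → {A // P A} := fun n => Nat.rec ⟨∅, h0⟩ f n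
  have hmono : Monotone fun n => (s n).1 := monotone_nat_of_le_succ fun n => hf n (s n)
  refine ⟨⋃ n, (s n).1, hU _ hmono fun n => (s n).2, fun B' hB' hsub => ?_⟩
  have hlim : ∀ n : ℕ, m B' ≤ m (⋃ n, (s n).1) + ((n : ℝ≥0∞) + 1)⁻¹ := fun n =>
    (hf' n (s n) B' hB' ((Set.subset_iUnion (fun n => (s n).1) n).trans hsub)).trans
      (by gcongr; exact Set.subset_iUnion (fun n => (s n).1) (n + 1))
  refine ENNReal.le_of_forall_pos_le_add fun ε hε _ => ?_
  obtain ⟨n, hn⟩ := ENNReal.exists_inv_nat_lt (ENNReal.coe_pos.2 hε).ne'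
  refine (hlim n).trans ?_
  gcongr
  exact (ENNReal.inv_le_inv.2 le_self_add).trans hn.le

/-- For every height `k` there is a column base `B` that takes up at least the fraction
`1 / (2 k)` of every invariant set. -/
theorem IsAperiodic.exists_column_base {m : Measure X} [IsFiniteMeasure m] {τ : X ≃ᵐ X}
    (hτ : MeasurePreserving τ m m) (haper : IsAperiodic m τ) {k : ℕ} (hk : 1 ≤ k) :
    ∃ B, MeasurableSet B ∧ NoReturnBefore τ B k ∧
      ∀ E, MeasurableSet E → τ ⁻¹' E = E → m E ≤ 2 * k * m (B ∩ E) := by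
  obtain ⟨B, ⟨hB, hret⟩, hmax⟩ := exists_measure_maximal m
    (P := fun B => MeasurableSet B ∧ NoReturnBefore τ B k) ⟨.empty, fun x hx => hx.elim⟩ <| by
      intro s hs hP
      refine ⟨.iUnion fun n => (hP n).1, fun x hx n h1 hn hx' => ?_⟩
      obtain ⟨i, hi⟩ := Set.mem_iUnion.1 hx
      obtain ⟨j, hj⟩ := Set.mem_iUnion.1 hx'
      exact (hP (max i j)).2 x (hs (le_max_left i j) hi) n h1 hn (hs (le_max_right i j) hj)
  refine ⟨B, hB, hret, fun E hE hinv => ?_⟩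
  have hpre : ∀ {A : Set X}, MeasurableSet A → ∀ i, MeasurableSet (τ^[i] ⁻¹' A) :=
    fun hA i => τ.measurable.iterate i hA
  -- The points fewer than `k` steps before or after a visit to `B`. Outside `R`, a set of positive
  -- measure would contain a piece that can be adjoined to `B`, against maximality.
  let R : Set X := (⋃ i : Fin k, τ^[i] ⁻¹' B) ∪ column τ B k
  have hR : MeasurableSet R :=
    (MeasurableSet.iUnion fun i : Fin k => hpre hB i).union (measurableSet_column τ hB k)
  have hRnull : m Rᶜ = 0 := by
    by_contra hne
    obtain ⟨A, hAR, hA, hApos, hAret⟩ :=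
      haper.exists_noReturnBefore hτ k hR.compl (pos_iff_ne_zero.2 hne)
    have hAB : Disjoint B A := by
      rw [Set.disjoint_left]
      exact fun x hx hxA => hAR hxA (Or.inl (Set.mem_iUnion.2 ⟨⟨0, hk⟩, hx⟩))
    have hle := hmax (B ∪ A) ⟨hB.union hA, ?_⟩ Set.subset_union_left
    · rw [measure_union hAB hA] at hle
      exact (ENNReal.lt_add_right (measure_ne_top m B) hApos.ne').not_ge hle
    · rintro x (hx | hx) n h1 hn (hx' | hx')
      · exact hret x hx n h1 hn hx'
      · exact hAR hx' (Or.inr (mem_column.2 ⟨n, hn, x, hx, rfl⟩))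
      · exact hAR hx (Or.inl (Set.mem_iUnion.2 ⟨⟨n, hn⟩, hx'⟩))
      · exact hAret x hx n h1 hn hx'
  have hEi : ∀ (i : ℕ) (x : X), τ^[i] x ∈ E ↔ x ∈ E := by
    intro i x
    induction i with
    | zero => rfl
    | succ i ih =>
      rw [Function.iterate_succ_apply', ← ih]
      exact Set.ext_iff.1 hinv _
  have hsub : E ⊆ Rᶜ ∪ ((⋃ i : Fin k, τ^[i] ⁻¹' (B ∩ E)) ∪ column τ (B ∩ E) k) := by
    intro x hx
    by_cases hxR : x ∈ R
    · right
      rcases hxR with h | h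
      · obtain ⟨i, hi⟩ := Set.mem_iUnion.1 h
        exact Or.inl (Set.mem_iUnion.2 ⟨i, hi, (hEi i x).2 hx⟩)
      · obtain ⟨i, hi, y, hy, rfl⟩ := mem_column.1 h
        exact Or.inr (mem_column.2 ⟨i, hi, y, ⟨hy, (hEi i y).1 hx⟩, rfl⟩)
    · exact Or.inl hxR
  have h1 : m (⋃ i : Fin k, τ^[i] ⁻¹' (B ∩ E)) ≤ k * m (B ∩ E) := by
    refine (measure_iUnion_fintype_le _ _).trans ?_
    simp only [(hτ.iterate _).measure_preimage (hB.inter hE).nullMeasurableSet]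
    simp
  have h2 : m (column τ (B ∩ E) k) = k * m (B ∩ E) :=
    ((hret.mono Set.inter_subset_left).isColumn (hB.inter hE) hk).measure_column hτ
  calc m E ≤ m Rᶜ + (m (⋃ i : Fin k, τ^[i] ⁻¹' (B ∩ E)) + m (column τ (B ∩ E) k)) :=
        (measure_mono hsub).trans ((measure_union_le _ _).trans
          (by gcongr; exact measure_union_le _ _))
    _ ≤ 0 + (k * m (B ∩ E) + k * m (B ∩ E)) := by rw [hRnull, h2]; gcongr
    _ = 2 * k * m (B ∩ E) := by ring

/-! ### Infinitely many invariant pieces -/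

/-- An aperiodic transformation with infinitely many disjoint invariant sets of positive measure
has a fat tower. -/
theorem exists_isFatTower_of_invariant_seq {m : Measure X} [IsFiniteMeasure m] {τ : X ≃ᵐ X}
    (hτ : MeasurePreserving τ m m) (haper : IsAperiodic m τ) {E : ℕ → Set X}
    (hE : ∀ n, MeasurableSet (E n)) (hinv : ∀ n, τ ⁻¹' E n = E n) (hpos : ∀ n, 0 < m (E n))
    (hdisj : Pairwise fun i j => Disjoint (E i) (E j)) :
    ∃ (B : ℕ → Set X) (k : ℕ → ℕ), IsFatTower m τ B k := by
  -- The constant 2 absorbs the lost half: `k * m C ≥ k * m (E n) / 2 ≥ 1`.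
  have hk : ∀ n, ∃ k : ℕ, 1 ≤ k ∧ 2 ≤ k * m (E n) := by
    intro n
    obtain ⟨k, hk⟩ := ENNReal.exists_nat_mul_gt (hpos n).ne' (b := 2) (by simp)
    refine ⟨k, Nat.one_le_iff_ne_zero.2 ?_, hk.le⟩
    rintro rfl
    simp at hk
  choose k hk1 hk2 using hk
  choose B hB hret hBE using fun n => haper.exists_column_base hτ (hk1 n)
  have hcol : ∀ n, IsColumn τ (B n ∩ E n) (k n) := fun n =>
    ((hret n).mono Set.inter_subset_left).isColumn ((hB n).inter (hE n)) (hk1 n)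
  have hsub : ∀ n, column τ (B n ∩ E n) (k n) ⊆ E n := by
    intro n x hx
    obtain ⟨i, -, y, hy, rfl⟩ := mem_column.1 hx
    have : Set.MapsTo τ (E n) (E n) := fun z hz => (Set.ext_iff.1 (hinv n) z).2 hz
    exact this.iterate i hy.2
  refine ⟨fun n => B n ∩ E n, k, ⟨hcol, fun i j hij => (hdisj hij).mono (hsub i) (hsub j)⟩, ?_⟩
  refine top_unique ((ENNReal.tsum_const_eq_top_of_ne_zero (α := ℕ) one_ne_zero).ge.trans
    (ENNReal.tsum_le_tsum fun n => ?_))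
  rw [(hcol n).measure_column hτ]
  refine (ENNReal.mul_le_mul_iff_right two_ne_zero ENNReal.ofNat_ne_top).1 ?_
  calc (2 : ℝ≥0∞) * 1 ≤ k n * m (E n) := by rw [mul_one]; exact hk2 n
    _ ≤ k n * (2 * k n * m (B n ∩ E n)) := by gcongr; exact hBE n _ (hE n) (hinv n)
    _ = 2 * (k n * (k n * m (B n ∩ E n))) := by ring

/-! ### The ergodic case: skyscrapers over a set -/

/-- Almost every orbit of an ergodic transformation visits a given set of positive measure. -/
theorem ae_exists_iterate_mem {μ : Measure X} [IsFiniteMeasure μ] {f : X → X} (hf : Ergodic f μ)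
    {A : Set X} (hA : MeasurableSet A) (hpos : 0 < μ A) : ∀ᵐ x ∂μ, ∃ n, f^[n] x ∈ A := by
  -- The points never visiting `A`. As `W ⊆ f ⁻¹' W`, ergodicity makes it null or conull, and it
  -- misses `A`.
  let W : Set X := ⋂ n, f^[n] ⁻¹' Aᶜ
  have hW : MeasurableSet W := .iInter fun n => hf.measurable.iterate n hA.compl
  have hle : W ⊆ f ⁻¹' W := fun x hx => Set.mem_iInter.2 fun n => by
    have := Set.mem_iInter.1 hx (n + 1)
    rwa [Set.mem_preimage, Function.iterate_succ_apply] at this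
  have h0 : μ W = 0 := by
    rcases hf.ae_empty_or_univ_of_ae_le_preimage hW.nullMeasurableSet hle.eventuallyLE with h | h
    · exact ae_eq_empty.1 h
    · refine absurd (measure_mono_null (fun x hx => ?_) (ae_eq_univ.1 h)) hpos.ne'
      exact fun hxW => Set.mem_iInter.1 hxW 0 hx
  filter_upwards [compl_mem_ae_iff.2 h0] with x hx
  by_contra! hcon
  exact hx (Set.mem_iInter.2 hcon)

/-- The points of `A` whose first return to `A` happens at time `k`. -/
def returnBase {X : Type*} (τ : X → X) (A : Set X) (k : ℕ) : Set X :=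
  {x | x ∈ A ∧ τ^[k] x ∈ A ∧ ∀ n, 1 ≤ n → n < k → τ^[n] x ∉ A}

theorem measurableSet_returnBase (τ : X ≃ᵐ X) {A : Set X} (hA : MeasurableSet A) (k : ℕ) :
    MeasurableSet (returnBase τ A k) := by
  have h : ∀ n, MeasurableSet (τ^[n] ⁻¹' A) := fun n => τ.measurable.iterate n hA
  have : returnBase τ A k =
      A ∩ (τ^[k] ⁻¹' A ∩ ⋂ (n : ℕ) (_ : 1 ≤ n) (_ : n < k), (τ^[n] ⁻¹' A)ᶜ) := by
    ext x
    simp only [returnBase, Set.mem_ofPred_eq, Set.mem_inter_iff, Set.mem_iInter, Set.mem_preimage,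
      Set.mem_compl_iff]
  rw [this]
  exact hA.inter ((h k).inter
    (.iInter fun n => .iInter fun _ => .iInter fun _ => (h n).compl))

/-- The skyscraper over `A`: its columns stand over the sets of constant return time. -/
theorem isTower_returnBase (τ : X ≃ᵐ X) {A : Set X} (hA : MeasurableSet A) :
    IsTower τ (fun n => returnBase τ A (n + 1)) (fun n => n + 1) where
  isColumn n := by
    refine NoReturnBefore.isColumn (fun x hx i h1 hi hx' => ?_)
      (measurableSet_returnBase τ hA _) (by omega)
    exact hx.2.2 i h1 hi hx'.1
  disjoint_columns := by
    have key : ∀ {a b i j : ℕ} {x y : X}, i ≤ j → j < b + 1 → x ∈ returnBase τ A (a + 1) →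
        y ∈ returnBase τ A (b + 1) → τ^[i] x = τ^[j] y → a = b := by
      intro a b i j x y hij hj hx hy hxy
      -- The orbit of `y` meets `A` at `x` before its first return, which forces `x = y`.
      have hx' : x = τ^[j - i] y := by
        refine τ.injective.iterate i ?_
        rw [hxy, ← Function.iterate_add_apply, Nat.add_sub_cancel' hij]
      have h0 : j - i = 0 := by
        by_contra hne
        exact hy.2.2 (j - i) (by omega) (by omega) (hx' ▸ hx.1)
      rw [h0, Function.iterate_zero_apply] at hx'
      subst hx'
      rcases lt_trichotomy a b with h | h | h
      · exact absurd hx.2.1 (hy.2.2 _ (by omega) (by omega))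
      · exact h
      · exact absurd hy.2.1 (hx.2.2 _ (by omega) (by omega))
    intro a b hab
    rw [Set.disjoint_left]
    intro z hz hz'
    obtain ⟨i, hi, x, hx, rfl⟩ := mem_column.1 hz
    obtain ⟨j, hj, y, hy, hxy⟩ := mem_column.1 hz'
    rcases le_total i j with hij | hij
    · exact hab (key hij hj hx hy hxy.symm)
    · exact hab (key hij hi hy hx hxy).symm

/-- If the column of height `k` over `D` avoids `A`, then the points of this column lie in the
columns of height at least `k` of the skyscraper over `A`. -/
theorem exists_mem_column_returnBase {τ : X ≃ᵐ X} {A D : Set X} {k : ℕ}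
    (hD : Disjoint (column τ D k) A) {x : X} (hx : x ∈ column τ D k)
    (hfut : ∃ n, τ^[n] x ∈ A) (hpast : ∃ n, τ.symm^[n] x ∈ A) :
    ∃ n, k ≤ n + 1 ∧ x ∈ column τ (returnBase τ A (n + 1)) (n + 1) := by
  classical
  have hxA : x ∉ A := Set.disjoint_left.1 hD hx
  obtain ⟨i, hi, y, hy, rfl⟩ := mem_column.1 hx
  have hyA : ∀ j < k, τ^[j] y ∉ A := fun j hj =>
    Set.disjoint_left.1 hD (mem_column.2 ⟨j, hj, y, hy, rfl⟩)
  set x := τ^[i] y with hxy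
  -- The next visit to `A` is `b` steps ahead and the last one `a` steps back. The run of `k` points
  -- off `A` lies strictly between them, so the return time `a + b` exceeds `k`, and `x` is on level
  -- `a`.
  set b := Nat.find hfut with hb
  set a := Nat.find hpast with ha
  have hbA : τ^[b] x ∈ A := Nat.find_spec hfut
  have haA : τ.symm^[a] x ∈ A := Nat.find_spec hpast
  have hb0 : 1 ≤ b := Nat.one_le_iff_ne_zero.2 fun h => hxA (by simpa [h] using hbA)
  have hia : i < a := by
    by_contra! h
    refine hyA (i - a) (by omega) ?_
    have : τ.symm^[a] x = τ^[i - a] y := by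
      rw [hxy, ← Nat.add_sub_cancel' h, Function.iterate_add_apply, symm_iterate_iterate,
        Nat.add_sub_cancel' h]
    rwa [← this]
  have hkb : k ≤ i + b := by
    by_contra! h
    refine hyA (b + i) (by omega) ?_
    rwa [Function.iterate_add_apply]
  have hback : ∀ n ≤ a, τ^[n] (τ.symm^[a] x) = τ.symm^[a - n] x := by
    intro n hn
    obtain ⟨c, hc⟩ := Nat.exists_eq_add_of_le hn
    rw [hc, Function.iterate_add_apply, iterate_symm_iterate, Nat.add_sub_cancel_left]
  have hforw : ∀ n, τ^[n + a] (τ.symm^[a] x) = τ^[n] x := fun n => by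
    rw [Function.iterate_add_apply, iterate_symm_iterate]
  refine ⟨a + b - 1, by omega, mem_column.2 ⟨a, by omega, τ.symm^[a] x, ?_,
    iterate_symm_iterate τ a x⟩⟩
  rw [Nat.sub_add_cancel (by omega)]
  refine ⟨haA, by rwa [add_comm, hforw], fun n h1 hn => ?_⟩
  rcases le_or_gt n a with h | h
  · rw [hback n h]
    exact Nat.find_min hpast (by omega)
  · obtain ⟨c, rfl⟩ := Nat.exists_eq_add_of_le' h.le
    rw [hforw]
    exact Nat.find_min hfut (by omega)

/-- Repeated splitting: the smaller of the two pieces has at most half the measure. -/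
theorem NonAtomic.exists_measure_pos_lt {μ : Measure X} [IsFiniteMeasure μ] (hμ : NonAtomic μ)
    (h0 : 0 < μ Set.univ) {ε : ℝ≥0∞} (hε : 0 < ε) :
    ∃ B, MeasurableSet B ∧ 0 < μ B ∧ μ B < ε := by
  have half : ∀ n : ℕ, ∃ B, MeasurableSet B ∧ 0 < μ B ∧ 2 ^ n * μ B ≤ μ Set.univ := by
    intro n
    induction n with
    | zero => exact ⟨Set.univ, .univ, h0, by simp⟩
    | succ n ih =>
      obtain ⟨A, hA, hApos, hAle⟩ := ih
      obtain ⟨B, hB, hBA, hBpos, hBlt⟩ := hμ A hA hApos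
      have hadd : μ B + μ (A \ B) = μ A := by
        rw [← measure_inter_add_sdiff A hB, Set.inter_eq_right.2 hBA]
      have hdiff : 0 < μ (A \ B) := by
        rw [pos_iff_ne_zero]
        intro h
        rw [h, add_zero] at hadd
        exact hBlt.ne hadd
      have hmain : ∀ C, 2 * μ C ≤ μ A → 2 ^ (n + 1) * μ C ≤ μ Set.univ := fun C hC =>
        calc 2 ^ (n + 1) * μ C = 2 ^ n * (2 * μ C) := by ring
          _ ≤ 2 ^ n * μ A := by gcongr
          _ ≤ μ Set.univ := hAle
      rcases le_total (μ B) (μ (A \ B)) with h | h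
      · exact ⟨B, hB, hBpos, hmain B (by rw [← hadd, two_mul]; gcongr)⟩
      · exact ⟨A \ B, hA.diff hB, hdiff, hmain _ (by rw [← hadd, two_mul]; gcongr)⟩
  obtain ⟨n, hn⟩ := ENNReal.exists_nat_mul_gt hε.ne' (measure_ne_top μ Set.univ)
  obtain ⟨B, hB, hBpos, hBle⟩ := half n
  refine ⟨B, hB, hBpos, ?_⟩
  by_contra! h
  refine (hn.trans_le ?_).not_ge hBle
  gcongr
  exact_mod_cast Nat.lt_two_pow_self.le

/-- A nonatomic ergodic transformation has unions of `k` consecutive images of a set that are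
small, but large in comparison with `1 / k`. -/
theorem exists_small_column {μ : Measure X} [IsFiniteMeasure μ] (hμ : NonAtomic μ) {τ : X ≃ᵐ X}
    (hτ : Ergodic τ μ) {c : ℝ≥0∞} (hc : 0 < c) (hcμ : c ≤ μ Set.univ) (N : ℕ) :
    ∃ (B : Set X) (k : ℕ), MeasurableSet B ∧ μ (column τ B k) ≤ c ∧
      N ≤ k * μ (column τ B k) := by
  classical
  have hct : c ≠ ∞ := ne_top_of_le_ne_top (measure_ne_top μ _) hcμ
  have hc2 : 0 < c / 2 := ENNReal.half_pos hc.ne'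
  have hc2t : c / 2 ≠ ∞ := ne_top_of_le_ne_top hct ENNReal.half_le_self
  -- The first bound keeps one extra level from overshooting `c`; the second forces many levels. For
  -- `N = 0` the quotient is `∞`.
  obtain ⟨B, hB, hBpos, hBlt⟩ := hμ.exists_measure_pos_lt (hc.trans_le hcμ)
    (ε := min (c / 2) (c / 2 * (c / 2) / N)) (lt_min hc2 (ENNReal.div_pos
      (mul_ne_zero hc2.ne' hc2.ne') (ENNReal.natCast_ne_top N)))
  have hex : ∃ k, c / 2 ≤ μ (column τ B k) := by
    have hmono : Monotone fun k => column τ B k := fun k l hkl x hx => by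
      obtain ⟨i, hi, h⟩ := mem_column.1 hx
      exact mem_column.2 ⟨i, hi.trans_le hkl, h⟩
    have huniv : μ (⋃ k, column τ B k) = μ Set.univ := by
      refine measure_congr (ae_eq_univ.2 ?_)
      filter_upwards [ae_exists_iterate_mem hτ.symm hB hBpos] with x ⟨n, hn⟩
      exact Set.mem_iUnion.2 ⟨n + 1, mem_column.2 ⟨n, by omega, _, hn, iterate_symm_iterate τ n x⟩⟩
    have hlt : c / 2 < ⨆ k, μ (column τ B k) := by
      rw [← hmono.measure_iUnion, huniv]
      exact (ENNReal.half_lt_self hc.ne' hct).trans_le hcμ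
    obtain ⟨k, hk⟩ := lt_iSup_iff.1 hlt
    exact ⟨k, hk.le⟩
  -- The first time the union reaches `c / 2`. Its levels may overlap, so only `μ (column τ B k) ≤ k
  -- * μ B` is available.
  set k := Nat.find hex with hk
  have hkc : c / 2 ≤ μ (column τ B k) := Nat.find_spec hex
  have hle : μ (column τ B k) ≤ k * μ B := by
    refine (measure_iUnion_fintype_le _ _).trans ?_
    simp [measure_level hτ.toMeasurePreserving hB]
  refine ⟨B, k, hB, ?_, ?_⟩
  · rcases hk0 : k with _ | l
    · simp [column]
    · have hl : μ (column τ B l) < c / 2 := not_le.1 (Nat.find_min hex (by omega))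
      have hsub : column τ B (l + 1) ⊆ column τ B l ∪ level τ B l := by
        intro x hx
        obtain ⟨i, hi, h⟩ := mem_column.1 hx
        rcases Nat.lt_succ_iff_lt_or_eq.1 hi with hi | rfl
        · exact Or.inl (mem_column.2 ⟨i, hi, h⟩)
        · exact Or.inr h
      calc μ (column τ B (l + 1)) ≤ μ (column τ B l) + μ (level τ B l) :=
            (measure_mono hsub).trans (measure_union_le _ _)
        _ ≤ c / 2 + c / 2 := by
          rw [measure_level hτ.toMeasurePreserving hB]
          exact add_le_add hl.le (hBlt.le.trans (min_le_left _ _))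
        _ = c := ENNReal.add_halves c
  · refine le_trans ?_ (mul_le_mul_right hkc _)
    refine (ENNReal.mul_le_mul_iff_left hBpos.ne' (measure_ne_top μ B)).1 ?_
    calc N * μ B ≤ N * (c / 2 * (c / 2) / N) := by
          gcongr
          exact hBlt.le.trans (min_le_right _ _)
      _ ≤ c / 2 * (c / 2) := ENNReal.mul_div_le
      _ ≤ k * μ B * (c / 2) := by gcongr; exact hkc.trans hle
      _ = k * (c / 2) * μ B := by ring

/-- A nonatomic ergodic transformation has a fat tower. -/
theorem exists_isFatTower_of_ergodic {μ : Measure X} [IsFiniteMeasure μ] (hμ : NonAtomic μ)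
    (h0 : 0 < μ Set.univ) {τ : X ≃ᵐ X} (hτ : Ergodic τ μ) :
    ∃ (B : ℕ → Set X) (k : ℕ → ℕ), IsFatTower μ τ B k := by
  -- The total of the `c N` stays below the full measure, leaving `A` positive measure.
  obtain ⟨c, hc, hsum⟩ := ENNReal.exists_pos_sum_of_countable' h0.ne' ℕ
  choose D k hD hDc hDN using fun N : ℕ =>
    exists_small_column hμ hτ (hc N) ((ENNReal.le_tsum N).trans hsum.le) N
  let A : Set X := (⋃ N, column τ (D N) (k N))ᶜ
  have hU : MeasurableSet (⋃ N, column τ (D N) (k N)) :=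
    .iUnion fun N => measurableSet_column τ (hD N) (k N)
  have hApos : 0 < μ A := by
    rw [pos_iff_ne_zero]
    intro h
    have hlt : μ (⋃ N, column τ (D N) (k N)) < μ Set.univ :=
      (measure_iUnion_le _).trans_lt ((ENNReal.tsum_le_tsum hDc).trans_lt hsum)
    exact hlt.ne (measure_congr (ae_eq_univ.2 h))
  have hDA : ∀ N, Disjoint (column τ (D N) (k N)) A := fun N =>
    disjoint_compl_right.mono_left (Set.subset_iUnion (fun N => column τ (D N) (k N)) N)
  refine ⟨fun n => returnBase τ A (n + 1), fun n => n + 1, isTower_returnBase τ hU.compl,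
    ENNReal.eq_top_of_forall_nnreal_le fun r => ?_⟩
  obtain ⟨N, hN⟩ := exists_nat_ge r
  let C : ℕ → Set X := fun n => column τ (returnBase τ A (n + 1)) (n + 1)
  have hcover : μ (column τ (D N) (k N)) ≤ ∑' n, if k N ≤ n + 1 then μ (C n) else 0 := by
    have hae : column τ (D N) (k N) ≤ᵐ[μ] ⋃ n, if k N ≤ n + 1 then C n else ∅ := by
      filter_upwards [ae_exists_iterate_mem hτ hU.compl hApos,
        ae_exists_iterate_mem hτ.symm hU.compl hApos] with x hfut hpast hx
      obtain ⟨n, hn, hxn⟩ := exists_mem_column_returnBase (hDA N) hx hfut hpast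
      exact Set.mem_iUnion.2 ⟨n, by rwa [if_pos hn]⟩
    refine (measure_mono_ae hae).trans ((measure_iUnion_le _).trans
      (ENNReal.tsum_le_tsum fun n => ?_))
    split_ifs <;> simp
  calc (r : ℝ≥0∞) ≤ N := by exact_mod_cast hN
    _ ≤ k N * μ (column τ (D N) (k N)) := hDN N
    _ ≤ k N * ∑' n, if k N ≤ n + 1 then μ (C n) else 0 := by gcongr
    _ = ∑' n, k N * if k N ≤ n + 1 then μ (C n) else 0 := ENNReal.tsum_mul_left.symm
    _ ≤ _ := ENNReal.tsum_le_tsum fun n => by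
      split_ifs with h
      · exact mul_le_mul_left (by exact_mod_cast h) _
      · simp

end FatTower

/-! ### The dichotomy on invariant sets -/

theorem theorem2 {X : Type*} [MeasurableSpace X] (m : MeasureTheory.Measure X)
    [MeasureTheory.IsProbabilityMeasure m] (hm : FatTower.NonAtomic m)
    (τ : X ≃ᵐ X) (hτ : MeasureTheory.MeasurePreserving τ m m)
    (haper : FatTower.IsAperiodic m τ) :
    ∃ (B : ℕ → Set X) (k : ℕ → ℕ), FatTower.IsFatTower m τ B k := by
  -- `E` is an atom of the invariant σ-algebra.
  by_cases hE : ∃ E, MeasurableSet E ∧ τ ⁻¹' E = E ∧ 0 < m E ∧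
      ∀ F ⊆ E, MeasurableSet F → τ ⁻¹' F = F → m F = 0 ∨ m F = m E
  · obtain ⟨E, hE, hinv, hpos, hsub⟩ := hE
    have hmp : MeasurePreserving τ (m.restrict E) (m.restrict E) := by
      simpa only [hinv] using hτ.restrict_preimage hE
    have herg : Ergodic τ (m.restrict E) := by
      refine ⟨hmp, ⟨fun s hs hsinv => ?_⟩⟩
      rw [Filter.eventuallyConst_set']
      rcases hsub (s ∩ E) Set.inter_subset_right (hs.inter hE)
        (by rw [Set.preimage_inter, hsinv, hinv]) with h | h
      · left
        rw [ae_eq_empty, Measure.restrict_apply hs, h]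
      · right
        rw [ae_eq_univ, Measure.restrict_apply hs.compl]
        have hadd := measure_inter_add_sdiff (μ := m) E hs
        rw [Set.inter_comm, h] at hadd
        have hz : m (E \ s) = 0 := by
          by_contra hne
          exact (ENNReal.lt_add_right (measure_ne_top m E) hne).ne' hadd
        rwa [Set.inter_comm]
    have hna : FatTower.NonAtomic (m.restrict E) := by
      intro A hA hApos
      rw [Measure.restrict_apply hA] at hApos ⊢
      obtain ⟨B, hB, hBA, hBpos, hBlt⟩ := hm _ (hA.inter hE) hApos
      have hBE : m.restrict E B = m B := by
        rw [Measure.restrict_apply hB,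
          Set.inter_eq_left.2 (hBA.trans Set.inter_subset_right)]
      exact ⟨B, hB, hBA.trans Set.inter_subset_left, hBE ▸ hBpos, hBE ▸ hBlt⟩
    obtain ⟨B, k, htower, htop⟩ :=
      FatTower.exists_isFatTower_of_ergodic hna (by simpa using hpos) herg
    refine ⟨B, k, htower, top_unique (htop.ge.trans (ENNReal.tsum_le_tsum fun n => ?_))⟩
    gcongr
    exact Measure.restrict_le_self
  · push Not at hE
    have step : ∀ S : {S : Set X // MeasurableSet S ∧ τ ⁻¹' S = S ∧ 0 < m S},
        ∃ T : {T : Set X // MeasurableSet T ∧ τ ⁻¹' T = T ∧ 0 < m T},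
          T.1 ⊆ S.1 ∧ m T.1 < m S.1 := by
      rintro ⟨S, hS, hinv, hpos⟩
      obtain ⟨F, hFS, hF, hFinv, hF0, hFne⟩ := hE S hS hinv hpos
      exact ⟨⟨F, hF, hFinv, pos_iff_ne_zero.2 hF0⟩, hFS, (measure_mono hFS).lt_of_ne hFne⟩
    choose f hf hlt using step
    let S : ℕ → {S : Set X // MeasurableSet S ∧ τ ⁻¹' S = S ∧ 0 < m S} := fun n =>
      f^[n] ⟨Set.univ, .univ, Set.preimage_univ, by simp⟩
    have hsucc : ∀ n, S (n + 1) = f (S n) := fun n => Function.iterate_succ_apply' f n _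
    have hanti : Antitone fun n => (S n).1 := antitone_nat_of_succ_le fun n => by
      rw [hsucc]
      exact hf (S n)
    -- Successive differences of the strictly decreasing invariant sets are disjoint, invariant and
    -- of positive measure.
    refine FatTower.exists_isFatTower_of_invariant_seq hτ haper
      (E := fun n => (S n).1 \ (S (n + 1)).1) (fun n => (S n).2.1.diff (S (n + 1)).2.1)
      (fun n => ?_) (fun n => ?_) ?_
    · rw [Set.preimage_sdiff, (S n).2.2.1, (S (n + 1)).2.2.1]
    · rw [hsucc, pos_iff_ne_zero]
      intro h
      exact (hlt (S n)).ne (measure_eq_measure_of_null_sdiff (hf (S n)) h)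
    · rw [pairwise_disjoint_on]
      intro i j hij
      rw [Set.disjoint_left]
      exact fun x hx hx' => hx.2 (hanti hij hx'.1)
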